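/- Let $0<\varepsilon<2$ and, for $x\in(0,1)$, let $$p(x)=(1-x)^{1+1/\varepsilon}(1+x)^{1-1/\varepsilon},\qquad w(x)=x^{-1}(1-x)^{1/\varepsilon}(1+x)^{-1/\varepsilon}.$$ In the complex Hilbert space $L^2((0,1),w(x)\,dx)$ let $L$ be the operator $Lf=-w^{-1}(pf')'$ with domain $\{f\in C^\infty([0,1]) : f(0)=0\}$, and let $L_c$ be the restriction of $L$ to $C_c^\infty(0,1)$, the space of smooth functions with compact support in $(0,1)$. Then $L$ is essentially self-adjoint, that is, $L$ is densely defined, symmetric and closable, and its closure $\overline{L}$ is self-adjoint. If moreover $0<\varepsilon\le 1$, then $L_c$ is closable and $\overline{L_c}=\overline{L}$. -/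

import Mathlib

noncomputable section

open MeasureTheory Set
open scoped ContDiff

namespace SturmLiouville

/-- `p(x) = (1-x)^{1+1/ε} (1+x)^{1-1/ε}`. -/
def p (ε x : ℝ) : ℝ := (1 - x) ^ (1 + 1 / ε) * (x + 1) ^ (1 - 1 / ε)

/-- `w(x) = x^{-1} (1-x)^{1/ε} (1+x)^{-1/ε}`. -/
def w (ε x : ℝ) : ℝ := x⁻¹ * (1 - x) ^ (1 / ε) * (x + 1) ^ (-(1 / ε))

/-- The measure `w(x) dx` on the interval `(0,1)`. -/
def wMeasure (ε : ℝ) : Measure ℝ :=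
  (volume.restrict (Ioo 0 1)).withDensity fun x => ENNReal.ofReal (w ε x)

/-- The complex Hilbert space `L²((0,1), w(x) dx)`. -/
abbrev L2w (ε : ℝ) : Type := Lp ℂ 2 (wMeasure ε)

/-- Functions that are smooth on the closed interval `[0,1]` (one-sided derivatives at the
endpoints) and vanish at `0`. Values outside `[0,1]` play no role. -/
def smoothZero : Submodule ℂ (ℝ → ℂ) where
  carrier := {f | ContDiffOn ℝ ∞ f (Icc 0 1) ∧ f 0 = 0}
  zero_mem' := ⟨contDiffOn_const, rfl⟩
  add_mem' hf hg := ⟨hf.1.add hg.1, by simp [hf.2, hg.2]⟩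
  smul_mem' c _ hf := ⟨contDiffOn_const.smul hf.1, by simp [hf.2]⟩

/-- Smooth functions with compact support contained in the open interval `(0,1)`. -/
def testFun : Submodule ℂ (ℝ → ℂ) where
  carrier := {f | ContDiff ℝ ∞ f ∧ HasCompactSupport f ∧ tsupport f ⊆ Ioo 0 1}
  zero_mem' := ⟨contDiff_const, HasCompactSupport.zero, by simp⟩
  add_mem' hf hg := ⟨hf.1.add hg.1, hf.2.1.add hg.2.1,
    (tsupport_add _ _).trans (union_subset hf.2.2 hg.2.2)⟩
  smul_mem' c f hf := ⟨contDiff_const.smul hf.1, hf.2.1.smul_left (f := fun _ => c),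
    (closure_mono (Function.support_const_smul_subset c f)).trans hf.2.2⟩

theorem testFun_le_smoothZero : testFun ≤ smoothZero := fun f hf =>
  ⟨hf.1.contDiffOn, by
    by_contra h
    have := hf.2.2 (subset_tsupport f h)
    simp at this⟩

/-- The differential expression `-w⁻¹ (p f')'`, used at points of `(0,1)`. -/
def expr (ε : ℝ) (f : ℝ → ℂ) (x : ℝ) : ℂ :=
  -((w ε x : ℂ)⁻¹ * deriv (fun y => (p ε y : ℂ) * deriv f y) x)

/-! ### Facts needed to see that the operator is well defined -/

theorem w_pos (ε : ℝ) {x : ℝ} (hx : x ∈ Ioo (0 : ℝ) 1) : 0 < w ε x := by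
  obtain ⟨h0, h1⟩ := hx
  have h2 : 0 < 1 - x := by linarith
  have h3 : 0 < x + 1 := by linarith
  unfold w
  positivity

theorem w_le {ε : ℝ} (hε : 0 < ε) {x : ℝ} (hx : x ∈ Ioo (0 : ℝ) 1) : w ε x ≤ x⁻¹ := by
  obtain ⟨h0, h1⟩ := hx
  have h2 : 0 < 1 - x := by linarith
  have h3 : 0 < x + 1 := by linarith
  have he : 0 < 1 / ε := by positivity
  have ha : (1 - x) ^ (1 / ε) ≤ 1 := Real.rpow_le_one h2.le (by linarith) he.le
  have hb : (x + 1) ^ (-(1 / ε)) ≤ 1 :=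
    Real.rpow_le_one_of_one_le_of_nonpos (by linarith) (by linarith)
  have ha' : 0 ≤ (1 - x) ^ (1 / ε) := by positivity
  have hb' : 0 ≤ (x + 1) ^ (-(1 / ε)) := by positivity
  have hc : (1 - x) ^ (1 / ε) * (x + 1) ^ (-(1 / ε)) ≤ 1 := mul_le_one₀ ha hb' hb
  unfold w
  rw [mul_assoc]
  have : 0 < x⁻¹ := by positivity
  nlinarith

theorem measurable_w (ε : ℝ) : Measurable (w ε) := by
  unfold w
  fun_prop

theorem p_eq {ε x : ℝ} (hx : x ∈ Ioo (0 : ℝ) 1) :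
    p ε x = w ε x * (x * (1 - x) * (x + 1)) := by
  obtain ⟨h0, h1⟩ := hx
  have h2 : 0 < 1 - x := by linarith
  have h3 : 0 < x + 1 := by linarith
  unfold p w
  rw [Real.rpow_add h2, sub_eq_add_neg 1 (1 / ε), Real.rpow_add h3, Real.rpow_one, Real.rpow_one]
  field_simp

theorem hasDerivAt_p {ε x : ℝ} (hx : x ∈ Ioo (0 : ℝ) 1) :
    HasDerivAt (p ε) (-(w ε x * (2 * x / ε + 2 * x ^ 2))) x := by
  obtain ⟨h0, h1⟩ := hx
  have h2 : 0 < 1 - x := by linarith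
  have h3 : 0 < x + 1 := by linarith
  have ha := ((hasDerivAt_id x).const_sub 1).rpow_const (p := 1 + 1 / ε) (Or.inl h2.ne')
  have hb := ((hasDerivAt_id x).add_const 1).rpow_const (p := 1 - 1 / ε) (Or.inl h3.ne')
  refine (ha.mul hb).congr_deriv ?_
  simp only [id]
  have e1 : (1 + 1 / ε - 1) = 1 / ε := by ring
  have e2 : (1 - 1 / ε - 1) = -(1 / ε) := by ring
  have e3 : (1 - x) ^ (1 + 1 / ε) = (1 - x) * (1 - x) ^ (1 / ε) := by
    rw [Real.rpow_add h2, Real.rpow_one]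
  have e4 : (x + 1) ^ (1 - 1 / ε) = (x + 1) * (x + 1) ^ (-(1 / ε)) := by
    rw [sub_eq_add_neg, Real.rpow_add h3, Real.rpow_one]
  rw [e1, e2, e3, e4]
  unfold w
  have : x⁻¹ * x = 1 := inv_mul_cancel₀ h0.ne'
  generalize (1 - x) ^ (1 / ε) = A
  generalize (x + 1) ^ (-(1 / ε)) = B
  have key : x⁻¹ * A * B * (2 * x / ε + 2 * x ^ 2) =
      (x⁻¹ * x) * (A * B * (2 / ε + 2 * x)) := by ring
  rw [key, this]
  ring

theorem ae_wMeasure_iff (ε : ℝ) {P : ℝ → Prop} :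
    (∀ᵐ x ∂wMeasure ε, P x) ↔ ∀ᵐ x ∂volume.restrict (Ioo (0 : ℝ) 1), P x := by
  unfold wMeasure
  rw [ae_withDensity_iff (measurable_w ε).ennreal_ofReal]
  have h := ae_restrict_mem (μ := volume) (measurableSet_Ioo (a := (0 : ℝ)) (b := 1))
  constructor <;> intro H
  · filter_upwards [H, h] with x hx hx1
    exact hx (by simpa using w_pos ε hx1)
  · filter_upwards [H] with x hx _ using hx

theorem ae_wMeasure_of_forall (ε : ℝ) {P : ℝ → Prop} (h : ∀ x ∈ Ioo (0 : ℝ) 1, P x) :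
    ∀ᵐ x ∂wMeasure ε, P x :=
  (ae_wMeasure_iff ε).2 (ae_restrict_of_forall_mem measurableSet_Ioo h)

theorem memLp_of_le {ε : ℝ} (hε : 0 < ε) {g : ℝ → ℂ} (hg : ContinuousOn g (Ioo 0 1)) {C : ℝ}
    (hC : ∀ x ∈ Ioo (0 : ℝ) 1, ‖g x‖ ≤ C * x) : MemLp g 2 (wMeasure ε) := by
  have hac : wMeasure ε ≪ volume.restrict (Ioo 0 1) := withDensity_absolutelyContinuous _ _
  have hm0 : AEStronglyMeasurable g (volume.restrict (Ioo 0 1)) :=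
    hg.aestronglyMeasurable measurableSet_Ioo
  have hm : AEStronglyMeasurable g (wMeasure ε) := hm0.mono_ac hac
  rw [memLp_two_iff_integrable_sq_norm hm]
  unfold wMeasure
  rw [integrable_withDensity_iff (measurable_w ε).ennreal_ofReal
    (Filter.Eventually.of_forall fun _ => ENNReal.ofReal_lt_top)]
  refine Integrable.mono' (g := fun _ => C ^ 2) ?_ ?_ ?_
  · simp
  · exact (hm0.norm.pow 2).mul
      (measurable_w ε).ennreal_ofReal.ennreal_toReal.aestronglyMeasurable
  · refine ae_restrict_of_forall_mem measurableSet_Ioo fun x hx => ?_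
    have hw := w_pos ε hx
    have hwl := w_le hε hx
    have hgx := hC x hx
    have hx0 : 0 < x := hx.1
    rw [ENNReal.toReal_ofReal hw.le, Real.norm_of_nonneg (by positivity)]
    have h1 : ‖g x‖ ^ 2 ≤ (C * x) ^ 2 := by gcongr
    calc ‖g x‖ ^ 2 * w ε x ≤ (C * x) ^ 2 * x⁻¹ := by gcongr
      _ = C ^ 2 * x := by field_simp
      _ ≤ C ^ 2 := by nlinarith [hx.2, sq_nonneg C]

theorem deriv_eq_derivWithin {f : ℝ → ℂ} {x : ℝ} (hx : x ∈ Ioo (0 : ℝ) 1) :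
    deriv f x = derivWithin f (Icc 0 1) x :=
  (derivWithin_of_mem_nhds (Icc_mem_nhds hx.1 hx.2)).symm

theorem smooth_derivWithin {f : ℝ → ℂ} (hf : ContDiffOn ℝ ∞ f (Icc 0 1)) :
    ContDiffOn ℝ ∞ (derivWithin f (Icc 0 1)) (Icc 0 1) :=
  hf.derivWithin (uniqueDiffOn_Icc one_pos) (by simp)

/-- On `(0,1)`, `-w⁻¹ (p f')' = -x(1-x)(1+x) f'' + (2x/ε + 2x²) f'`. -/
theorem expr_eq (ε : ℝ) {f : ℝ → ℂ} (hf : ContDiffOn ℝ ∞ f (Icc 0 1)) {x : ℝ}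
    (hx : x ∈ Ioo (0 : ℝ) 1) :
    expr ε f x =
      -((x * (1 - x) * (x + 1) : ℝ) : ℂ) * derivWithin (derivWithin f (Icc 0 1)) (Icc 0 1) x
        + ((2 * x / ε + 2 * x ^ 2 : ℝ) : ℂ) * derivWithin f (Icc 0 1) x := by
  have hn : Icc (0 : ℝ) 1 ∈ nhds x := Icc_mem_nhds hx.1 hx.2
  have hxI : x ∈ Icc (0 : ℝ) 1 := Ioo_subset_Icc_self hx
  have h1 : HasDerivAt (derivWithin f (Icc 0 1))
      (derivWithin (derivWithin f (Icc 0 1)) (Icc 0 1) x) x :=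
    (((smooth_derivWithin hf).differentiableOn (by simp)) x hxI).hasDerivWithinAt.hasDerivAt hn
  have h2 : HasDerivAt (deriv f)
      (derivWithin (derivWithin f (Icc 0 1)) (Icc 0 1) x) x := by
    refine h1.congr_of_eventuallyEq ?_
    filter_upwards [isOpen_Ioo.mem_nhds hx] with y hy using deriv_eq_derivWithin hy
  have h3 := ((hasDerivAt_p (ε := ε) hx).ofReal_comp.mul h2).deriv
  have hw : (w ε x : ℂ) ≠ 0 := by exact_mod_cast (w_pos ε hx).ne'
  unfold expr
  have h4 : deriv (fun y => (p ε y : ℂ) * deriv f y) x = _ := h3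
  rw [h4, p_eq hx, deriv_eq_derivWithin hx]
  push_cast
  field_simp
  ring

theorem memLp_smooth {ε : ℝ} (hε : 0 < ε) {f : ℝ → ℂ} (hf : f ∈ smoothZero) :
    MemLp f 2 (wMeasure ε) := by
  obtain ⟨hs, h0⟩ := hf
  obtain ⟨C, hC⟩ := isCompact_Icc.exists_bound_of_continuousOn (smooth_derivWithin hs).continuousOn
  refine memLp_of_le hε (hs.continuousOn.mono Ioo_subset_Icc_self) (C := C) fun x hx => ?_
  have := (convex_Icc (0 : ℝ) 1).norm_image_sub_le_of_norm_derivWithin_le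
    (hs.differentiableOn (by simp)) hC (left_mem_Icc.2 zero_le_one) (Ioo_subset_Icc_self hx)
  simpa [h0, abs_of_pos hx.1] using this

theorem memLp_expr {ε : ℝ} (hε : 0 < ε) {f : ℝ → ℂ} (hf : f ∈ smoothZero) :
    MemLp (expr ε f) 2 (wMeasure ε) := by
  obtain ⟨hs, -⟩ := hf
  have c1 := (smooth_derivWithin hs).continuousOn
  have c2 := (smooth_derivWithin (smooth_derivWithin hs)).continuousOn
  set d1 := derivWithin f (Icc 0 1) with hd1
  set d2 := derivWithin d1 (Icc 0 1) with hd2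
  let h : ℝ → ℂ := fun x => -(((1 - x) * (x + 1) : ℝ) : ℂ) * d2 x
    + ((2 / ε + 2 * x : ℝ) : ℂ) * d1 x
  have hh : ContinuousOn h (Icc 0 1) := by
    have a1 : Continuous fun x : ℝ => -(((1 - x) * (x + 1) : ℝ) : ℂ) := by fun_prop
    have a2 : Continuous fun x : ℝ => ((2 / ε + 2 * x : ℝ) : ℂ) := by fun_prop
    exact (a1.continuousOn.mul c2).add (a2.continuousOn.mul c1)
  have he : ∀ x ∈ Ioo (0 : ℝ) 1, expr ε f x = (x : ℂ) * h x := fun x hx => by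
    rw [expr_eq ε hs hx]
    simp only [h]
    push_cast
    ring
  obtain ⟨C, hC⟩ := isCompact_Icc.exists_bound_of_continuousOn hh
  refine memLp_of_le hε (C := C) ?_ fun x hx => ?_
  · refine ContinuousOn.congr ?_ he
    exact Complex.continuous_ofReal.continuousOn.mul (hh.mono Ioo_subset_Icc_self)
  · rw [he x hx, norm_mul, Complex.norm_real, Real.norm_of_nonneg hx.1.le, mul_comm]
    exact mul_le_mul_of_nonneg_right (hC x (Ioo_subset_Icc_self hx)) hx.1.le

theorem differentiableOn_Icc {f : ℝ → ℂ} (hf : ContDiffOn ℝ ∞ f (Icc 0 1)) :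
    DifferentiableOn ℝ f (Icc 0 1) := hf.differentiableOn (by simp)

theorem expr_add (ε : ℝ) {f g : ℝ → ℂ} (hf : f ∈ smoothZero) (hg : g ∈ smoothZero) {x : ℝ}
    (hx : x ∈ Ioo (0 : ℝ) 1) : expr ε (f + g) x = expr ε f x + expr ε g x := by
  have h1 : EqOn (derivWithin (f + g) (Icc 0 1))
      (derivWithin f (Icc 0 1) + derivWithin g (Icc 0 1)) (Icc 0 1) := fun y hy =>
    derivWithin_add (differentiableOn_Icc hf.1 y hy) (differentiableOn_Icc hg.1 y hy)
  have hxI : x ∈ Icc (0 : ℝ) 1 := Ioo_subset_Icc_self hx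
  rw [expr_eq ε (smoothZero.add_mem hf hg).1 hx, expr_eq ε hf.1 hx, expr_eq ε hg.1 hx,
    derivWithin_congr h1 (h1 hxI), h1 hxI,
    derivWithin_add (differentiableOn_Icc (smooth_derivWithin hf.1) x hxI)
      (differentiableOn_Icc (smooth_derivWithin hg.1) x hxI), Pi.add_apply]
  ring

theorem expr_smul (ε : ℝ) (c : ℂ) {f : ℝ → ℂ} (hf : f ∈ smoothZero) {x : ℝ}
    (hx : x ∈ Ioo (0 : ℝ) 1) : expr ε (c • f) x = c * expr ε f x := by
  have h1 : EqOn (derivWithin (c • f) (Icc 0 1))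
      (c • derivWithin f (Icc 0 1)) (Icc 0 1) := fun y hy =>
    derivWithin_const_smul c (differentiableOn_Icc hf.1 y hy)
  have hxI : x ∈ Icc (0 : ℝ) 1 := Ioo_subset_Icc_self hx
  rw [expr_eq ε (smoothZero.smul_mem c hf).1 hx, expr_eq ε hf.1 hx,
    derivWithin_congr h1 (h1 hxI), h1 hxI,
    derivWithin_const_smul c (differentiableOn_Icc (smooth_derivWithin hf.1) x hxI),
    Pi.smul_apply, smul_eq_mul, smul_eq_mul]
  ring

/-! ### The operators -/

/-- The map sending a smooth function to its class in `L²((0,1), w dx)`. -/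
def toL2w {ε : ℝ} (hε : 0 < ε) : smoothZero →ₗ[ℂ] L2w ε where
  toFun f := (memLp_smooth hε f.2).toLp f.1
  map_add' f g := MemLp.toLp_add (memLp_smooth hε f.2) (memLp_smooth hε g.2)
  map_smul' c f := MemLp.toLp_const_smul c (memLp_smooth hε f.2)

/-- The map sending a smooth function `f` to the class of `-w⁻¹ (p f')'`. -/
def exprL2w {ε : ℝ} (hε : 0 < ε) : smoothZero →ₗ[ℂ] L2w ε where
  toFun f := (memLp_expr hε f.2).toLp (expr ε f.1)
  map_add' f g := by
    rw [← MemLp.toLp_add (memLp_expr hε f.2) (memLp_expr hε g.2)]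
    exact MemLp.toLp_congr _ _ (ae_wMeasure_of_forall ε fun x hx => expr_add ε f.2 g.2 hx)
  map_smul' c f := by
    rw [RingHom.id_apply, ← MemLp.toLp_const_smul c (memLp_expr hε f.2)]
    exact MemLp.toLp_congr _ _ (ae_wMeasure_of_forall ε fun x hx => expr_smul ε c f.2 hx)

theorem ker_toL2w_le {ε : ℝ} (hε : 0 < ε) :
    LinearMap.ker (toL2w hε) ≤ LinearMap.ker (exprL2w hε) := by
  intro f hf
  rw [LinearMap.mem_ker] at hf ⊢
  have hf0 : (f : ℝ → ℂ) =ᵐ[wMeasure ε] 0 :=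
    (MemLp.toLp_eq_toLp_iff (memLp_smooth hε f.2) (MemLp.zero' (p := 2))).1 hf
  have hae : (f : ℝ → ℂ) =ᵐ[volume.restrict (Ioo (0 : ℝ) 1)] 0 := (ae_wMeasure_iff ε).1 hf0
  have heq : EqOn (f : ℝ → ℂ) 0 (Ioo 0 1) :=
    Measure.eqOn_open_of_ae_eq hae isOpen_Ioo
      (f.2.1.continuousOn.mono Ioo_subset_Icc_self) continuousOn_const
  have hd : EqOn (deriv (f : ℝ → ℂ)) 0 (Ioo 0 1) := fun x hx => by
    have h : (f : ℝ → ℂ) =ᶠ[nhds x] fun _ => 0 := heq.eventuallyEq_of_mem (isOpen_Ioo.mem_nhds hx)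
    rw [h.deriv_eq, deriv_const, Pi.zero_apply]
  have he : ∀ x ∈ Ioo (0 : ℝ) 1, expr ε f x = 0 := fun x hx => by
    have h : (fun y => (p ε y : ℂ) * deriv (f : ℝ → ℂ) y) =ᶠ[nhds x] fun _ => 0 := by
      filter_upwards [isOpen_Ioo.mem_nhds hx] with y hy
      simp [hd hy]
    rw [expr, h.deriv_eq, deriv_const, mul_zero, neg_zero]
  exact (MemLp.toLp_eq_toLp_iff (memLp_expr hε f.2) (MemLp.zero' (p := 2))).2
    (ae_wMeasure_of_forall ε he)

/-- The Sturm–Liouville operator `L f = -w⁻¹ (p f')'` in `L²((0,1), w dx)`, with domain (the classes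
of) the functions `f ∈ C^∞([0,1])` with `f(0) = 0`; see `L_apply`. -/
def L {ε : ℝ} (hε : 0 < ε) : L2w ε →ₗ.[ℂ] L2w ε where
  domain := LinearMap.range (toL2w hε)
  toFun := ((LinearMap.ker (toL2w hε)).liftQ (exprL2w hε) (ker_toL2w_le hε)).comp
    (toL2w hε).quotKerEquivRange.symm.toLinearMap

theorem L_apply {ε : ℝ} (hε : 0 < ε) (f : smoothZero) :
    L hε ⟨toL2w hε f, LinearMap.mem_range_self _ f⟩ = exprL2w hε f := by
  change (LinearMap.ker (toL2w hε)).liftQ (exprL2w hε) (ker_toL2w_le hε)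
    ((toL2w hε).quotKerEquivRange.symm ⟨toL2w hε f, LinearMap.mem_range_self _ f⟩) = _
  rw [LinearMap.quotKerEquivRange_symm_apply_image]
  rfl

/-- The restriction `L_c` of `L` to (the classes of) functions in `C_c^∞(0,1)`. -/
def Lc {ε : ℝ} (hε : 0 < ε) : L2w ε →ₗ.[ℂ] L2w ε :=
  (L hε).domRestrict ((testFun.comap smoothZero.subtype).map (toL2w hε))

theorem Lc_domain {ε : ℝ} (hε : 0 < ε) :
    (Lc hε).domain = (testFun.comap smoothZero.subtype).map (toL2w hε) :=
  inf_eq_left.2 LinearMap.map_le_range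

end SturmLiouville

/-- A densely defined operator on a Hilbert space is essentially self-adjoint if it is symmetric
and its closure is self-adjoint. -/
def LinearPMap.IsEssentiallySelfAdjoint {H : Type*} [NormedAddCommGroup H]
    [InnerProductSpace ℂ H] [CompleteSpace H] (T : H →ₗ.[ℂ] H) : Prop :=
  Dense (T.domain : Set H) ∧ T.IsFormalAdjoint T ∧ T.IsClosable ∧ IsSelfAdjoint T.closure

end

/-! The proof rests on an abstract criterion
(`LinearPMap.IsFormalAdjoint.isEssentiallySelfAdjoint`): a symmetric, densely defined `T` with `c‖x‖
≤ ‖T x‖` and dense range has a surjective closure, and since the kernel of the adjoint is orthogonal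
to the range, the adjoint cannot exceed the closure.

Symmetry of `L` is integration by parts: `⟨f, L g⟩ = ∫ p f̄' g'`, with boundary terms killed by
`f(0) = 0` and `p(1) = 0`. The lower bound `L ≥ 2/ε` is a Hardy-type inequality: the function `x`
satisfies `L x = (2/ε + 2x) x`, and comparing `f'` with `f/x` writes `p|f'|² - w(2/ε + 2x)|f|²` as a
square plus the derivative of `p|f|²/x` (`hasDerivAt_p_mul_norm_sq_div`). The range is dense because
`L f = g` is solved explicitly for every test function `g` by `solution`.

For `L_c`, write `P = ∫₀ˣ 1/p`, so that `1` and `P` span the solutions of `(p f')' = 0`. The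
explicit solution has compact support as soon as `w g` annihilates `1` and `P`. Hence if `u` is
orthogonal to the range of `L_c`, then `ū = α + βP` almost everywhere. The weight `1/x` excludes `α
≠ 0`, and for `ε ≤ 1` the growth of `P` at `1` excludes `β ≠ 0`. So `L_c` has dense range too, and
with the lower bound this forces its closure to be that of `L` (`closure_eq_of_le_of_denseRange`).
-/

/-! ### Symmetric operators that are bounded below and have dense range -/

namespace LinearPMap

variable {H : Type*} [NormedAddCommGroup H] [InnerProductSpace ℂ H] [CompleteSpace H]

/-- The closure of an operator that is bounded below and has dense range is surjective. -/
theorem exists_mem_graph_closure {T : H →ₗ.[ℂ] H} (hT : T.IsClosable) {c : ℝ} (hc : 0 < c)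
    (hb : ∀ x : T.domain, c * ‖(x : H)‖ ≤ ‖T x‖) (hr : DenseRange T) (v : H) :
    ∃ x, (x, v) ∈ T.closure.graph := by
  obtain ⟨y, hy, hyv⟩ := mem_closure_iff_seq_limit.1 (hr v)
  choose x hx using hy
  have hTx : Filter.Tendsto (fun n => T (x n)) Filter.atTop (nhds v) := by simpa only [hx] using hyv
  have hcau : CauchySeq fun n => (x n : H) := by
    have h1 := hTx.cauchySeq
    rw [Metric.cauchySeq_iff] at h1 ⊢
    intro δ hδ
    obtain ⟨N, hN⟩ := h1 (c * δ) (by positivity)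
    refine ⟨N, fun m hm n hn => ?_⟩
    have h2 := hN m hm n hn
    have h3 := hb (x m - x n)
    rw [dist_eq_norm] at h2 ⊢
    rw [map_sub, Submodule.coe_sub] at h3
    exact lt_of_mul_lt_mul_left (h3.trans_lt h2) hc.le
  obtain ⟨z, hz⟩ := cauchySeq_tendsto_of_complete hcau
  refine ⟨z, ?_⟩
  rw [← hT.graph_closure_eq_closure_graph]
  refine mem_closure_of_tendsto (hz.prodMk_nhds hTx) (Filter.Eventually.of_forall fun n => ?_)
  exact T.mem_graph (x n)

/-- Symmetry places `T` below its adjoint, which is closed. -/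
theorem IsFormalAdjoint.isClosable {T : H →ₗ.[ℂ] H} (hs : T.IsFormalAdjoint T)
    (hd : Dense (T.domain : Set H)) : T.IsClosable :=
  (adjoint_isClosed hd).isClosable.leIsClosable (hs.le_adjoint hd)

/-- For fixed `y`, the adjoint relation is a closed condition on points of `H × H`, so it passes
from the graph of `T` to its closure. -/
theorem adjoint_closure {T : H →ₗ.[ℂ] H} (hd : Dense (T.domain : Set H)) (hc : T.IsClosable) :
    T.closure.adjoint = T.adjoint := by
  have hle := T.le_closure
  have hd' : Dense (T.closure.domain : Set H) := hd.mono hle.1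
  refine le_antisymm ?_ ?_
  · refine IsFormalAdjoint.le_adjoint hd fun x y => ?_
    rw [hle.2 (y := ⟨x, hle.1 x.2⟩) rfl]
    exact (adjoint_isFormalAdjoint hd').symm _ _
  · refine IsFormalAdjoint.le_adjoint hd' fun x y => ?_
    have hx := T.closure.mem_graph x
    rw [← hc.graph_closure_eq_closure_graph] at hx
    have hcl : _root_.IsClosed {q : H × H | inner ℂ q.2 (y : H) = inner ℂ q.1 (T.adjoint y)} :=
      isClosed_eq (by fun_prop) (by fun_prop)
    refine closure_minimal (fun q hq => ?_) hcl hx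
    obtain ⟨z, hz1, hz2⟩ := T.mem_graph_iff.1 hq
    change inner ℂ q.2 (y : H) = inner ℂ q.1 (T.adjoint y)
    rw [← hz1, ← hz2]
    exact (adjoint_isFormalAdjoint hd).symm z y

/-- A symmetric, densely defined operator that is bounded below and has dense range is essentially
self-adjoint. -/
theorem IsFormalAdjoint.isEssentiallySelfAdjoint {T : H →ₗ.[ℂ] H} (hs : T.IsFormalAdjoint T)
    (hd : Dense (T.domain : Set H)) {c : ℝ} (hc : 0 < c)
    (hb : ∀ x : T.domain, c * ‖(x : H)‖ ≤ ‖T x‖) (hr : DenseRange T) :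
    T.IsEssentiallySelfAdjoint := by
  have hcl := hs.isClosable hd
  refine ⟨hd, hs, hcl, ?_⟩
  rw [isSelfAdjoint_def, adjoint_closure hd hcl]
  have hle : T.closure ≤ T.adjoint := by
    refine le_of_le_graph ?_
    rw [← hcl.graph_closure_eq_closure_graph]
    exact Submodule.topologicalClosure_minimal _ (le_graph_of_le (hs.le_adjoint hd))
      (adjoint_isClosed hd)
  refine le_antisymm (le_of_le_graph ?_) hle
  rintro ⟨y, v⟩ hy
  -- The closure attains the value `v` of the adjoint at `y`, at some `x`. Then `y - x` is in the
  -- kernel of the adjoint, hence orthogonal to the dense range, so `y = x`.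
  obtain ⟨x, hx⟩ := exists_mem_graph_closure hcl hc hb hr v
  have hx' := le_graph_of_le hle hx
  have hsub := Submodule.sub_mem _ hy hx'
  obtain ⟨z, hz1, hz2⟩ := (mem_graph_iff _).1 hsub
  have hz : (z : H) = 0 := hr.eq_zero_of_inner_left ℂ fun t => by
    rw [← adjoint_isFormalAdjoint hd z t, hz2]
    simp
  rw [hz] at hz1
  have hyx : y = x := (sub_eq_zero.1 hz1.symm : y = x)
  rw [hyx]
  exact hx

/-- If the restriction of an operator that is bounded below has dense range, then the two operators
have the same closure. -/
theorem closure_eq_of_le_of_denseRange {S T : H →ₗ.[ℂ] H} (hST : S ≤ T) (hT : T.IsClosable)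
    {c : ℝ} (hc : 0 < c) (hb : ∀ x : T.domain, c * ‖(x : H)‖ ≤ ‖T x‖) (hr : DenseRange S) :
    S.closure = T.closure := by
  refine le_antisymm (hT.closure_mono hST) (le_of_le_graph ?_)
  have hbS : ∀ x : S.domain, c * ‖(x : H)‖ ≤ ‖S x‖ := fun x => by
    rw [hST.2 (y := ⟨x, hST.1 x.2⟩) rfl]
    exact hb ⟨x, hST.1 x.2⟩
  rintro ⟨y, v⟩ hy
  -- The closure of `S` attains `v` at some `x`, so `(y - x, 0)` is in the graph of the closure of
  -- `T`, where the lower bound persists and gives `y = x`.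
  obtain ⟨x, hx⟩ := exists_mem_graph_closure (hT.leIsClosable hST) hc hbS hr v
  have hsub := Submodule.sub_mem _ hy (le_graph_of_le (hT.closure_mono hST) hx)
  rw [← hT.graph_closure_eq_closure_graph] at hsub
  have hcl : _root_.IsClosed {q : H × H | c * ‖q.1‖ ≤ ‖q.2‖} :=
    isClosed_le (by fun_prop) (by fun_prop)
  have h0 : c * ‖y - x‖ ≤ ‖v - v‖ := by
    refine closure_minimal (fun q hq => ?_) hcl hsub
    obtain ⟨z, hz1, hz2⟩ := T.mem_graph_iff.1 hq
    change c * ‖q.1‖ ≤ ‖q.2‖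
    rw [← hz1, ← hz2]
    exact hb z
  rw [sub_self, norm_zero] at h0
  have hyx : y = x := by
    rw [← sub_eq_zero, ← norm_le_zero_iff]
    exact nonpos_of_mul_nonpos_right h0 hc
  rw [hyx]
  exact hx

end LinearPMap

noncomputable section

open MeasureTheory Set
open scoped ContDiff ComplexConjugate

namespace SturmLiouville

/-! ### Integration by parts and the lower bound -/

theorem integral_wMeasure (ε : ℝ) (g : ℝ → ℂ) :
    ∫ x, g x ∂wMeasure ε = ∫ x in (0 : ℝ)..1, (w ε x : ℂ) * g x := by
  rw [intervalIntegral.integral_of_le zero_le_one, integral_Ioc_eq_integral_Ioo, wMeasure,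
    integral_withDensity_eq_integral_toReal_smul (measurable_w ε).ennreal_ofReal
      (Filter.Eventually.of_forall fun _ => ENNReal.ofReal_lt_top)]
  refine setIntegral_congr_fun measurableSet_Ioo fun x hx => ?_
  simp only [ENNReal.toReal_ofReal (w_pos ε hx).le, Complex.real_smul]

theorem integrable_wMeasure_iff (ε : ℝ) (g : ℝ → ℂ) :
    Integrable g (wMeasure ε) ↔ IntegrableOn (fun x => (w ε x : ℂ) * g x) (Ioo 0 1) := by
  rw [wMeasure, integrable_withDensity_iff_integrable_smul' (measurable_w ε).ennreal_ofReal
      (Filter.Eventually.of_forall fun _ => ENNReal.ofReal_lt_top)]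
  refine integrableOn_congr_fun (fun x hx => ?_) measurableSet_Ioo
  simp only [ENNReal.toReal_ofReal (w_pos ε hx).le, Complex.real_smul]

theorem inner_toLp {ε : ℝ} {f g : ℝ → ℂ} (hf : MemLp f 2 (wMeasure ε))
    (hg : MemLp g 2 (wMeasure ε)) :
    inner ℂ (hf.toLp f) (hg.toLp g) = ∫ x in (0 : ℝ)..1, (w ε x : ℂ) * (conj (f x) * g x) := by
  rw [L2.inner_def, ← integral_wMeasure]
  refine integral_congr_ae ?_
  filter_upwards [hf.coeFn_toLp, hg.coeFn_toLp] with x h1 h2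
  rw [h1, h2, RCLike.inner_apply, mul_comm]

theorem intervalIntegrable_w_mul {ε : ℝ} {f g : ℝ → ℂ} (hf : MemLp f 2 (wMeasure ε))
    (hg : MemLp g 2 (wMeasure ε)) :
    IntervalIntegrable (fun x => (w ε x : ℂ) * (conj (f x) * g x)) volume 0 1 := by
  rw [intervalIntegrable_iff_integrableOn_Ioo_of_le zero_le_one, ← integrable_wMeasure_iff]
  exact hf.star.integrable_mul hg

theorem integrableOn_w_mul_norm_sq {ε : ℝ} {u : ℝ → ℂ} (hu : MemLp u 2 (wMeasure ε)) :
    IntegrableOn (fun x => w ε x * ‖u x‖ ^ 2) (Ioo 0 1) := by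
  have := (intervalIntegrable_w_mul hu hu).norm
  rw [intervalIntegrable_iff_integrableOn_Ioo_of_le zero_le_one] at this
  refine this.congr_fun (fun x hx => ?_) measurableSet_Ioo
  simp [abs_of_pos (w_pos ε hx), sq]

theorem continuousOn_p {ε : ℝ} (hε : 0 < ε) : ContinuousOn (p ε) (Icc 0 1) := by
  have h1 : (0 : ℝ) ≤ 1 + 1 / ε := by positivity
  unfold p
  refine ContinuousOn.mul ?_ ?_
  · exact (continuousOn_const.sub continuousOn_id).rpow_const fun x _ => Or.inr h1
  · refine (continuousOn_id.add continuousOn_const).rpow_const fun x hx => Or.inl ?_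
    have := hx.1
    exact (by linarith : (0 : ℝ) < x + 1).ne'

theorem p_one {ε : ℝ} (hε : 0 < ε) : p ε 1 = 0 := by
  have h1 : (1 + 1 / ε) ≠ 0 := by positivity
  rw [p, sub_self, Real.zero_rpow h1, zero_mul]

theorem p_pos (ε : ℝ) {x : ℝ} (hx : x ∈ Ioo (-1 : ℝ) 1) : 0 < p ε x := by
  have h2 : 0 < 1 - x := by linarith [hx.2]
  have h3 : 0 < x + 1 := by linarith [hx.1]
  unfold p
  positivity

theorem hasDerivAt_derivWithin {f : ℝ → ℂ} (hf : ContDiffOn ℝ ∞ f (Icc 0 1)) {x : ℝ}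
    (hx : x ∈ Ioo (0 : ℝ) 1) : HasDerivAt f (derivWithin f (Icc 0 1) x) x :=
  (differentiableOn_Icc hf x (Ioo_subset_Icc_self hx)).hasDerivWithinAt.hasDerivAt
    (Icc_mem_nhds hx.1 hx.2)

/-- Using `derivWithin` in place of the `deriv` of `expr` makes the flux continuous up to both
endpoints, as integration by parts over `[0,1]` requires. -/
theorem hasDerivAt_p_mul {ε : ℝ} {f : ℝ → ℂ} (hf : ContDiffOn ℝ ∞ f (Icc 0 1)) {x : ℝ}
    (hx : x ∈ Ioo (0 : ℝ) 1) :
    HasDerivAt (fun y => (p ε y : ℂ) * derivWithin f (Icc 0 1) y) (-(w ε x * expr ε f x)) x := by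
  refine ((hasDerivAt_p (ε := ε) hx).ofReal_comp.mul
    (hasDerivAt_derivWithin (smooth_derivWithin hf) hx)).congr_deriv ?_
  rw [expr_eq ε hf hx, p_eq hx]
  push_cast
  ring

/-- Integration by parts: `⟨f, L g⟩ = ∫ p f̄' g'`. -/
theorem inner_toL2w_exprL2w {ε : ℝ} (hε : 0 < ε) (f g : smoothZero) :
    inner ℂ (toL2w hε f) (exprL2w hε g) =
      ∫ x in (0 : ℝ)..1, (p ε x : ℂ) *
        (conj (derivWithin f.1 (Icc 0 1) x) * derivWithin g.1 (Icc 0 1) x) := by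
  have hfi := memLp_smooth hε f.2
  have hgi := memLp_expr hε g.2
  have hp : ContinuousOn (fun x => (p ε x : ℂ)) (Icc 0 1) :=
    Complex.continuous_ofReal.comp_continuousOn (continuousOn_p hε)
  have hDf := (smooth_derivWithin f.2.1).continuousOn
  have hDg := (smooth_derivWithin g.2.1).continuousOn
  have hi1 := intervalIntegrable_w_mul hfi hgi
  have hi2 : IntervalIntegrable (fun x => (p ε x : ℂ) *
      (conj (derivWithin f.1 (Icc 0 1) x) * derivWithin g.1 (Icc 0 1) x)) volume 0 1 := by
    refine ContinuousOn.intervalIntegrable ?_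
    rw [uIcc_of_le zero_le_one]
    exact hp.mul ((Complex.continuous_conj.comp_continuousOn hDf).mul hDg)
  -- The primitive `p g' f̄` vanishes at `1` through `p` and at `0` through `f`; differentiability
  -- is needed only in the interior.
  have key := intervalIntegral.integral_eq_sub_of_hasDerivAt_of_le zero_le_one
    (f := fun x => ((p ε x : ℂ) * derivWithin g.1 (Icc 0 1) x) * conj (f.1 x))
    (f' := fun x => (p ε x : ℂ) *
      (conj (derivWithin f.1 (Icc 0 1) x) * derivWithin g.1 (Icc 0 1) x) -
        (w ε x : ℂ) * (conj (f.1 x) * expr ε g.1 x))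
    ((hp.mul hDg).mul (Complex.continuous_conj.comp_continuousOn f.2.1.continuousOn))
    (fun x hx => by
      refine ((hasDerivAt_p_mul g.2.1 hx).mul
        (hasDerivAt_derivWithin f.2.1 hx).star).congr_deriv ?_
      simp only [Complex.star_def]
      ring) (hi2.sub hi1)
  rw [intervalIntegral.integral_sub hi2 hi1, p_one hε, f.2.2] at key
  simp only [Complex.ofReal_zero, zero_mul, map_zero, mul_zero, sub_zero] at key
  refine (inner_toLp hfi hgi).trans ?_
  rw [sub_eq_zero] at key
  exact key.symm

theorem inner_exprL2w_toL2w {ε : ℝ} (hε : 0 < ε) (f g : smoothZero) :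
    inner ℂ (exprL2w hε f) (toL2w hε g) = inner ℂ (toL2w hε f) (exprL2w hε g) := by
  rw [← inner_conj_symm, inner_toL2w_exprL2w, inner_toL2w_exprL2w, intervalIntegral,
    intervalIntegral]
  simp only [Ioc_eq_empty (not_lt.2 zero_le_one), Measure.restrict_empty, integral_zero_measure,
    sub_zero]
  rw [← integral_conj]
  refine integral_congr_ae (Filter.Eventually.of_forall fun x => ?_)
  simp only [map_mul, Complex.conj_ofReal, Complex.conj_conj]
  ring

/-- Completing the square around `f' = f/x`, the relation satisfied by multiples of `x`, produces
the potential `2/ε + 2x` from `p'/x`. -/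
theorem hasDerivAt_p_mul_norm_sq_div {ε : ℝ} {f : ℝ → ℂ} (hf : ContDiffOn ℝ ∞ f (Icc 0 1))
    {x : ℝ} (hx : x ∈ Ioo (0 : ℝ) 1) :
    HasDerivAt (fun y => p ε y * (‖f y‖ ^ 2 / y))
      (p ε x * ‖derivWithin f (Icc 0 1) x‖ ^ 2 - w ε x * (2 / ε + 2 * x) * ‖f x‖ ^ 2 -
        p ε x * ‖derivWithin f (Icc 0 1) x - x⁻¹ • f x‖ ^ 2) x := by
  have hx0 : x ≠ 0 := hx.1.ne'
  refine ((hasDerivAt_p (ε := ε) hx).mul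
    ((hasDerivAt_derivWithin hf hx).norm_sq.div (hasDerivAt_id x) hx0)).congr_deriv ?_
  rw [norm_sub_sq_real, inner_smul_right, norm_smul, Real.norm_of_nonneg (inv_nonneg.2 hx.1.le),
    real_inner_comm]
  simp only [id, Pi.div_apply]
  field_simp
  ring

/-- The operator is bounded below by `2 / ε`. -/
theorem norm_sq_toL2w_le {ε : ℝ} (hε : 0 < ε) (f : smoothZero) :
    2 / ε * ‖toL2w hε f‖ ^ 2 ≤ (inner ℂ (toL2w hε f) (exprL2w hε f)).re := by
  have hfi := memLp_smooth hε f.2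
  have hDf := (smooth_derivWithin f.2.1).continuousOn
  have hi1 : IntervalIntegrable (fun x => w ε x * ‖f.1 x‖ ^ 2) volume 0 1 :=
    (intervalIntegrable_iff_integrableOn_Ioo_of_le zero_le_one).2 (integrableOn_w_mul_norm_sq hfi)
  have hi2 : IntervalIntegrable (fun x => p ε x * ‖derivWithin f.1 (Icc 0 1) x‖ ^ 2)
      volume 0 1 := by
    refine ContinuousOn.intervalIntegrable ?_
    rw [uIcc_of_le zero_le_one]
    exact (continuousOn_p hε).mul (hDf.norm.pow 2)
  have e1 : ‖toL2w hε f‖ ^ 2 = ∫ x in (0 : ℝ)..1, w ε x * ‖f.1 x‖ ^ 2 := by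
    have h2 := inner_toLp hfi hfi
    change inner ℂ (toL2w hε f) (toL2w hε f) = _ at h2
    have h3 : ∫ x in (0 : ℝ)..1, (w ε x : ℂ) * (conj (f.1 x) * f.1 x) =
        ((∫ x in (0 : ℝ)..1, w ε x * ‖f.1 x‖ ^ 2 : ℝ) : ℂ) := by
      rw [← intervalIntegral.integral_ofReal]
      congr 1
      ext x
      rw [Complex.conj_mul']
      push_cast
      rfl
    rw [← inner_self_eq_norm_sq (𝕜 := ℂ), h2, h3]
    exact Complex.ofReal_re _
  have e2 : (inner ℂ (toL2w hε f) (exprL2w hε f)).re =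
      ∫ x in (0 : ℝ)..1, p ε x * ‖derivWithin f.1 (Icc 0 1) x‖ ^ 2 := by
    have h3 : ∫ x in (0 : ℝ)..1, (p ε x : ℂ) *
        (conj (derivWithin f.1 (Icc 0 1) x) * derivWithin f.1 (Icc 0 1) x) =
        ((∫ x in (0 : ℝ)..1, p ε x * ‖derivWithin f.1 (Icc 0 1) x‖ ^ 2 : ℝ) : ℂ) := by
      rw [← intervalIntegral.integral_ofReal]
      congr 1
      ext x
      rw [Complex.conj_mul']
      push_cast
      rfl
    rw [inner_toL2w_exprL2w, h3, Complex.ofReal_re]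
  obtain ⟨C, hC⟩ := isCompact_Icc.exists_bound_of_continuousOn hDf
  have hbd : ∀ x ∈ Icc (0 : ℝ) 1, ‖f.1 x‖ ≤ C * x := fun x hx => by
    have := (convex_Icc (0 : ℝ) 1).norm_image_sub_le_of_norm_derivWithin_le
      (differentiableOn_Icc f.2.1) hC (left_mem_Icc.2 zero_le_one) hx
    simpa [f.2.2, abs_of_nonneg hx.1] using this
  -- At `0` the quotient has the default value `0`, which is also its limit because `‖f y‖² / y ≤ C²
  -- y`.
  have hcont : ContinuousOn (fun y => p ε y * (‖f.1 y‖ ^ 2 / y)) (Icc 0 1) := by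
    refine (continuousOn_p hε).mul fun x hx => ?_
    rcases hx.1.eq_or_lt with rfl | h0
    · change Filter.Tendsto _ _ _
      simp only [f.2.2, norm_zero, div_zero]
      have hlim : Filter.Tendsto (fun y : ℝ => C ^ 2 * y) (nhdsWithin 0 (Icc 0 1)) (nhds 0) := by
        have : Continuous fun y : ℝ => C ^ 2 * y := by fun_prop
        simpa using this.continuousWithinAt (s := Icc 0 1) (x := 0) |>.tendsto
      refine squeeze_zero' ?_ ?_ hlim
      · filter_upwards [self_mem_nhdsWithin] with y hy
        have := hy.1
        positivity
      · filter_upwards [self_mem_nhdsWithin] with y hy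
        rcases hy.1.eq_or_lt with rfl | hy0
        · simp
        · rw [div_le_iff₀ hy0]
          calc ‖f.1 y‖ ^ 2 ≤ (C * y) ^ 2 := by
                gcongr
                exact hbd y hy
            _ = C ^ 2 * y * y := by ring
    · exact ((f.2.1.continuousOn x hx).norm.pow 2).div continuousWithinAt_id h0.ne'
  -- Integrating an inequality for the derivative discards the square and the `2x` term without
  -- requiring their integrability. The primitive is `0` at both ends.
  have key := intervalIntegral.sub_le_integral_of_hasDeriv_right_of_le zero_le_one hcont
    (fun x hx => (hasDerivAt_p_mul_norm_sq_div (ε := ε) f.2.1 hx).hasDerivWithinAt)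
    (φ := fun x => p ε x * ‖derivWithin f.1 (Icc 0 1) x‖ ^ 2 - 2 / ε * (w ε x * ‖f.1 x‖ ^ 2))
    (by
      rw [← intervalIntegrable_iff_integrableOn_Icc_of_le zero_le_one]
      exact hi2.sub (hi1.const_mul _))
    (fun x hx => by
      have h1 : 0 ≤ p ε x * ‖derivWithin f.1 (Icc 0 1) x - x⁻¹ • f.1 x‖ ^ 2 :=
        mul_nonneg (p_pos ε ⟨by linarith [hx.1], hx.2⟩).le (by positivity)
      have h2 : 0 ≤ w ε x * ‖f.1 x‖ ^ 2 * (2 * x) := by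
        have := w_pos ε hx
        have := hx.1
        positivity
      linarith)
  rw [intervalIntegral.integral_sub hi2 (hi1.const_mul _), intervalIntegral.integral_const_mul,
    p_one hε, f.2.2] at key
  rw [e1, e2]
  simpa using key

theorem L_isFormalAdjoint {ε : ℝ} (hε : 0 < ε) : (L hε).IsFormalAdjoint (L hε) := by
  rintro ⟨_, f, rfl⟩ ⟨_, g, rfl⟩
  rw [L_apply, L_apply]
  exact inner_exprL2w_toL2w hε f g

theorem L_bounded_below {ε : ℝ} (hε : 0 < ε) (x : (L hε).domain) :
    2 / ε * ‖(x : L2w ε)‖ ≤ ‖L hε x‖ := by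
  obtain ⟨_, f, rfl⟩ := x
  rw [L_apply]
  rcases (norm_nonneg (toL2w hε f)).eq_or_lt with h | h
  · change 2 / ε * ‖toL2w hε f‖ ≤ _
    rw [← h, mul_zero]
    exact norm_nonneg _
  · refine le_of_mul_le_mul_right ?_ h
    calc 2 / ε * ‖toL2w hε f‖ * ‖toL2w hε f‖ = 2 / ε * ‖toL2w hε f‖ ^ 2 := by ring
      _ ≤ (inner ℂ (toL2w hε f) (exprL2w hε f)).re := norm_sq_toL2w_le hε f
      _ ≤ ‖toL2w hε f‖ * ‖exprL2w hε f‖ := re_inner_le_norm (𝕜 := ℂ) _ _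
      _ = _ := mul_comm _ _

/-! ### Test functions -/

theorem contDiffAt_w (ε : ℝ) {x : ℝ} (hx : x ∈ Ioo (0 : ℝ) 1) : ContDiffAt ℝ ∞ (w ε) x := by
  have h2 : 1 - x ≠ 0 := by linarith [hx.2]
  have h3 : x + 1 ≠ 0 := by linarith [hx.1]
  unfold w
  exact ((contDiffAt_id.inv hx.1.ne').mul
    ((contDiffAt_const.sub contDiffAt_id).rpow_const_of_ne h2)).mul
    ((contDiffAt_id.add contDiffAt_const).rpow_const_of_ne h3)

theorem contDiffAt_p (ε : ℝ) {x : ℝ} (hx : x ∈ Ioo (-1 : ℝ) 1) : ContDiffAt ℝ ∞ (p ε) x := by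
  have h2 : 1 - x ≠ 0 := by linarith [hx.2]
  have h3 : x + 1 ≠ 0 := by linarith [hx.1]
  unfold p
  exact ((contDiffAt_const.sub contDiffAt_id).rpow_const_of_ne h2).mul
    ((contDiffAt_id.add contDiffAt_const).rpow_const_of_ne h3)

theorem continuousOn_w (ε : ℝ) : ContinuousOn (fun x => (w ε x : ℂ)) (Ioo 0 1) := fun _ hx =>
  (Complex.continuous_ofReal.continuousAt.comp (contDiffAt_w ε hx).continuousAt).continuousWithinAt

theorem mem_testFun_of_eq_zero {f : ℝ → ℂ} (hf : ContDiff ℝ ∞ f) {a b : ℝ} (ha : 0 < a)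
    (hb : b < 1) (h : ∀ x ∉ Icc a b, f x = 0) : f ∈ testFun := by
  have hs : tsupport f ⊆ Icc a b :=
    closure_minimal (fun x hx => by_contra fun h' => hx (h x h')) isClosed_Icc
  exact ⟨hf, isCompact_Icc.of_isClosed_subset (isClosed_tsupport f) hs,
    hs.trans fun x hx => ⟨ha.trans_le hx.1, hx.2.trans_lt hb⟩⟩

theorem exists_eq_zero_of_mem_testFun {f : ℝ → ℂ} (hf : f ∈ testFun) :
    ∃ a b : ℝ, 0 < a ∧ a < b ∧ b < 1 ∧ ∀ x ∉ Icc a b, f x = 0 := by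
  rcases (tsupport f).eq_empty_or_nonempty with h | h
  · refine ⟨1 / 3, 1 / 2, by norm_num, by norm_num, by norm_num, fun x _ => ?_⟩
    exact image_eq_zero_of_notMem_tsupport (by simp [h])
  · have hc : IsCompact (tsupport f) := hf.2.1
    have h1 := hf.2.2 (hc.sInf_mem h)
    have h2 := hf.2.2 (hc.sSup_mem h)
    have h12 : sInf (tsupport f) ≤ sSup (tsupport f) := csInf_le_csSup h hc.bddBelow hc.bddAbove
    refine ⟨sInf (tsupport f), (sSup (tsupport f) + 1) / 2, h1.1, ?_, ?_, fun x hx => ?_⟩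
    · linarith [h2.2]
    · linarith [h2.2]
    · by_contra h0
      have hx' := subset_tsupport f h0
      exact hx ⟨csInf_le hc.bddBelow hx', by linarith [le_csSup hc.bddAbove hx', h2.2]⟩

theorem mul_mem_testFun {a f : ℝ → ℂ} (ha : ∀ x ∈ Ioo (0 : ℝ) 1, ContDiffAt ℝ ∞ a x)
    (hf : f ∈ testFun) : (fun x => a x * f x) ∈ testFun := by
  have hs : tsupport (fun x => a x * f x) ⊆ tsupport f :=
    closure_mono (Function.support_mul_subset_right a f)
  refine ⟨contDiff_iff_contDiffAt.2 fun x => ?_, hf.2.1.mul_left, hs.trans hf.2.2⟩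
  by_cases hx : x ∈ tsupport f
  · exact (ha x (hf.2.2 hx)).mul hf.1.contDiffAt
  · refine contDiffAt_const (c := (0 : ℂ)) |>.congr_of_eventuallyEq ?_
    filter_upwards [(isClosed_tsupport f).isOpen_compl.mem_nhds hx] with y hy
    rw [image_eq_zero_of_notMem_tsupport hy, mul_zero]

theorem w_mul_mem_testFun (ε : ℝ) {f : ℝ → ℂ} (hf : f ∈ testFun) :
    (fun x => (w ε x : ℂ) * f x) ∈ testFun :=
  mul_mem_testFun (fun _ hx => Complex.ofRealCLM.contDiff.contDiffAt.comp _ (contDiffAt_w ε hx)) hf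

/-- Only local integrability of `w a` is asked, because `a` will also be `1` and `P`, which need not
be square integrable. -/
theorem intervalIntegrable_pairing {ε : ℝ} {a f : ℝ → ℂ}
    (ha : LocallyIntegrableOn (fun x => (w ε x : ℂ) * a x) (Ioo 0 1)) (hf : f ∈ testFun) :
    IntervalIntegrable (fun x => (w ε x : ℂ) * (a x * f x)) volume 0 1 := by
  rw [intervalIntegrable_iff_integrableOn_Ioo_of_le zero_le_one]
  have h1 : IntegrableOn (fun x => (w ε x : ℂ) * a x) (tsupport f) :=
    ha.integrableOn_compact_subset hf.2.2 hf.2.1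
  have h2 : IntegrableOn (fun x => (w ε x : ℂ) * a x * f x) (tsupport f) :=
    h1.mul_continuousOn hf.1.continuous.continuousOn hf.2.1
  have h3 : Integrable (fun x => (w ε x : ℂ) * a x * f x) :=
    (integrableOn_iff_integrable_of_support_subset fun x hx =>
      subset_tsupport f (right_ne_zero_of_mul hx)).1 h2
  simpa only [mul_assoc] using h3.integrableOn

/-- The functional `f ↦ ∫ w a f` on test functions. -/
def pairing {ε : ℝ} {a : ℝ → ℂ}
    (ha : LocallyIntegrableOn (fun x => (w ε x : ℂ) * a x) (Ioo 0 1)) : testFun →ₗ[ℂ] ℂ where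
  toFun f := ∫ x in (0 : ℝ)..1, (w ε x : ℂ) * (a x * f.1 x)
  map_add' f g := by
    rw [← intervalIntegral.integral_add (intervalIntegrable_pairing ha f.2)
      (intervalIntegrable_pairing ha g.2)]
    simp only [Submodule.coe_add, Pi.add_apply, mul_add]
  map_smul' c f := by
    rw [RingHom.id_apply, smul_eq_mul, ← intervalIntegral.integral_const_mul]
    congr 1
    ext x
    simp only [Submodule.coe_smul, Pi.smul_apply, smul_eq_mul]
    ring

/-- This is the fundamental lemma of the calculus of variations applied to `w a`, followed by
division by `w > 0`. -/
theorem ae_eq_zero_of_pairing_eq_zero {ε : ℝ} {a : ℝ → ℂ}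
    (ha : LocallyIntegrableOn (fun x => (w ε x : ℂ) * a x) (Ioo 0 1)) (h : pairing ha = 0) :
    a =ᵐ[wMeasure ε] 0 := by
  have key := isOpen_Ioo.ae_eq_zero_of_integral_contDiff_smul_eq_zero ha fun g hg hgc hgs => by
    have hm : (fun x => (g x : ℂ)) ∈ testFun := by
      have hs : tsupport (fun x => (g x : ℂ)) ⊆ tsupport g :=
        closure_mono fun x hx h0 => hx (by simp [h0])
      exact ⟨Complex.ofRealCLM.contDiff.comp hg,
        hgc.of_isClosed_subset (isClosed_tsupport _) hs, hs.trans hgs⟩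
    have h1 : ∫ x in (0 : ℝ)..1, (w ε x : ℂ) * (a x * g x) = 0 := LinearMap.congr_fun h ⟨_, hm⟩
    rw [intervalIntegral.integral_of_le zero_le_one, integral_Ioc_eq_integral_Ioo,
      setIntegral_eq_integral_of_forall_compl_eq_zero] at h1
    · rw [← h1]
      congr 1
      ext x
      rw [Complex.real_smul]
      ring
    · intro x hx
      have : g x = 0 := image_eq_zero_of_notMem_tsupport fun h' => hx (hgs h')
      simp [this]
  refine (ae_wMeasure_iff ε).2 ?_
  rw [ae_restrict_iff' measurableSet_Ioo]
  filter_upwards [key] with x hx hx1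
  have hw : (w ε x : ℂ) ≠ 0 := by exact_mod_cast (w_pos ε hx1).ne'
  exact (mul_eq_zero.1 (hx hx1)).resolve_left hw

theorem ofReal_mem_smoothZero : (fun x : ℝ => (x : ℂ)) ∈ smoothZero :=
  ⟨Complex.ofRealCLM.contDiff.contDiffOn, Complex.ofReal_zero⟩

/-- The function `x` is square integrable for `w`, so `w ū x` is integrable on `(0,1)`; dividing by
`x` costs nothing on compact subsets. -/
theorem locallyIntegrableOn_of_memLp {ε : ℝ} (hε : 0 < ε) {u : ℝ → ℂ}
    (hu : MemLp u 2 (wMeasure ε)) :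
    LocallyIntegrableOn (fun x => (w ε x : ℂ) * conj (u x)) (Ioo 0 1) := by
  have h1 := intervalIntegrable_w_mul hu (memLp_smooth hε ofReal_mem_smoothZero)
  rw [intervalIntegrable_iff_integrableOn_Ioo_of_le zero_le_one] at h1
  have hc : ContinuousOn (fun x : ℝ => (x : ℂ)⁻¹) (Ioo 0 1) :=
    Complex.continuous_ofReal.continuousOn.inv₀ fun x hx => by exact_mod_cast hx.1.ne'
  have h2 := h1.locallyIntegrableOn.mul_continuousOn hc isOpen_Ioo.isLocallyClosed
  rw [locallyIntegrableOn_iff isOpen_Ioo.isLocallyClosed] at h2 ⊢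
  refine fun K hK hKc => (h2 K hK hKc).congr_fun (fun x hx => ?_) hKc.measurableSet
  have hx0 : (x : ℂ) ≠ 0 := by exact_mod_cast (hK hx).1.ne'
  field_simp

theorem inner_toL2w {ε : ℝ} (hε : 0 < ε) (u : L2w ε) (f : testFun) :
    inner ℂ u (toL2w hε ⟨f.1, testFun_le_smoothZero f.2⟩) =
      pairing (locallyIntegrableOn_of_memLp hε (Lp.memLp u)) f := by
  have h := inner_toLp (Lp.memLp u) (memLp_smooth hε (testFun_le_smoothZero f.2))
  rw [Lp.toLp_coeFn] at h
  exact h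

/-- Test functions are dense in `L²((0,1), w dx)`. -/
theorem eq_zero_of_inner_testFun {ε : ℝ} (hε : 0 < ε) {u : L2w ε}
    (h : ∀ f : testFun, inner ℂ u (toL2w hε ⟨f.1, testFun_le_smoothZero f.2⟩) = 0) : u = 0 := by
  have h0 := ae_eq_zero_of_pairing_eq_zero (locallyIntegrableOn_of_memLp hε (Lp.memLp u))
    (LinearMap.ext fun f => by rw [← inner_toL2w hε u f, h f, LinearMap.zero_apply])
  refine (Lp.eq_zero_iff_ae_eq_zero).2 ?_
  filter_upwards [h0] with x hx
  simpa using hx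

theorem dense_L_domain {ε : ℝ} (hε : 0 < ε) : Dense ((L hε).domain : Set (L2w ε)) := by
  rw [Submodule.dense_iff_topologicalClosure_eq_top, Submodule.topologicalClosure_eq_top_iff,
    Submodule.eq_bot_iff]
  intro u hu
  refine eq_zero_of_inner_testFun hε fun f => ?_
  exact (Submodule.mem_orthogonal' _ u).1 hu _ (LinearMap.mem_range_self _ _)

/-! ### Solving `L f = g` for a test function `g` -/

theorem hasDerivAt_integral_of_continuousOn {E : Type*} [NormedAddCommGroup E] [NormedSpace ℝ E]
    [CompleteSpace E] {F : ℝ → E} {s : Set ℝ} (hs : IsOpen s) (hc : s.OrdConnected)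
    (hF : ContinuousOn F s) {a x : ℝ} (ha : a ∈ s) (hx : x ∈ s) :
    HasDerivAt (fun y => ∫ t in a..y, F t) (F x) x :=
  intervalIntegral.integral_hasDerivAt_right
    (hF.mono (hc.uIcc_subset ha hx)).intervalIntegrable
    (hF.stronglyMeasurableAtFilter hs x hx) (hF.continuousAt (hs.mem_nhds hx))

theorem contDiffOn_integral {E : Type*} [NormedAddCommGroup E] [NormedSpace ℝ E]
    [CompleteSpace E] {F : ℝ → E} {s : Set ℝ} (hs : IsOpen s) (hc : s.OrdConnected)
    (hF : ContDiffOn ℝ ∞ F s) {a : ℝ} (ha : a ∈ s) :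
    ContDiffOn ℝ ∞ (fun y => ∫ t in a..y, F t) s := by
  have h := fun x (hx : x ∈ s) => hasDerivAt_integral_of_continuousOn hs hc hF.continuousOn ha hx
  rw [contDiffOn_infty_iff_deriv_of_isOpen hs]
  exact ⟨fun x hx => (h x hx).differentiableAt.differentiableWithinAt,
    hF.congr fun x hx => (h x hx).deriv⟩

/-- The solution `∫₀ˣ 1/p` of `(p f')' = 0`. -/
def invPrimitive (ε x : ℝ) : ℝ := ∫ t in (0 : ℝ)..x, (p ε t)⁻¹

theorem contDiffOn_inv_p (ε : ℝ) : ContDiffOn ℝ ∞ (fun x => (p ε x)⁻¹) (Ioo (-1) 1) := fun _ hx =>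
  ((contDiffAt_p ε hx).inv (p_pos ε hx).ne').contDiffWithinAt

/-- Since `p` is smooth and positive on `(-1,1)`, the point `0` is interior and needs no one-sided
analysis. -/
theorem contDiffOn_invPrimitive (ε : ℝ) : ContDiffOn ℝ ∞ (invPrimitive ε) (Ioo (-1) 1) :=
  contDiffOn_integral isOpen_Ioo ordConnected_Ioo (contDiffOn_inv_p ε) (by norm_num)

theorem hasDerivAt_invPrimitive (ε : ℝ) {x : ℝ} (hx : x ∈ Ioo (-1 : ℝ) 1) :
    HasDerivAt (invPrimitive ε) (p ε x)⁻¹ x :=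
  hasDerivAt_integral_of_continuousOn isOpen_Ioo ordConnected_Ioo
    (contDiffOn_inv_p ε).continuousOn (by norm_num) hx

theorem invPrimitive_zero (ε : ℝ) : invPrimitive ε 0 = 0 := intervalIntegral.integral_same

/-- The flux `∫ₓ¹ w g` of the solution of `L f = g`. -/
def flux (ε : ℝ) (g : ℝ → ℂ) (x : ℝ) : ℂ := -∫ t in (1 : ℝ)..x, (w ε t : ℂ) * g t

/-- The solution `∫₀ˣ p⁻¹ ∫ᵧ¹ w g` of `L f = g`. -/
def solution (ε : ℝ) (g : ℝ → ℂ) (x : ℝ) : ℂ := ∫ t in (0 : ℝ)..x, (p ε t : ℂ)⁻¹ * flux ε g t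

variable {ε : ℝ} {g : ℝ → ℂ}

theorem hasDerivAt_flux (hg : g ∈ testFun) (x : ℝ) :
    HasDerivAt (flux ε g) (-((w ε x : ℂ) * g x)) x :=
  (hasDerivAt_integral_of_continuousOn isOpen_univ ordConnected_univ
    (w_mul_mem_testFun ε hg).1.continuous.continuousOn (mem_univ _) (mem_univ _)).neg

theorem contDiff_flux (hg : g ∈ testFun) : ContDiff ℝ ∞ (flux ε g) :=
  (contDiffOn_univ.1 (contDiffOn_integral isOpen_univ ordConnected_univ
    (w_mul_mem_testFun ε hg).1.contDiffOn (mem_univ _))).neg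

theorem flux_eq_zero {a b : ℝ} (hb : b < 1) (h : ∀ x ∉ Icc a b, g x = 0) {x : ℝ} (hx : b < x) :
    flux ε g x = 0 := by
  rw [flux, intervalIntegral.integral_congr (g := fun _ => 0), intervalIntegral.integral_zero,
    neg_zero]
  intro t ht
  have ht1 : b < t := (lt_min hb hx).trans_le ht.1
  simp only [h t fun h' => ht1.not_ge h'.2, mul_zero]

theorem flux_eq_integral (hg : g ∈ testFun) {a b : ℝ} (ha : 0 < a) (h : ∀ x ∉ Icc a b, g x = 0)
    {x : ℝ} (hx : x < a) : flux ε g x = ∫ t in (0 : ℝ)..1, (w ε t : ℂ) * g t := by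
  have hc := (w_mul_mem_testFun ε hg).1.continuous
  have h0 : ∫ t in x..0, (w ε t : ℂ) * g t = 0 := by
    rw [intervalIntegral.integral_congr (g := fun _ => 0), intervalIntegral.integral_zero]
    intro t ht
    have ht1 : t < a := ht.2.trans_lt (max_lt hx ha)
    simp only [h t fun h' => ht1.not_ge h'.1, mul_zero]
  rw [flux, ← intervalIntegral.integral_symm, ← intervalIntegral.integral_add_adjacent_intervals
    (hc.intervalIntegrable x 0) (hc.intervalIntegrable 0 1), h0, zero_add]

/-- The singularity of `1/p` at `1` is invisible, since the flux vanishes to the right of the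
support of `g`. This gives smoothness of the solution up to `1`. -/
theorem contDiffOn_inv_p_mul_flux (hg : g ∈ testFun) :
    ContDiffOn ℝ ∞ (fun x => (p ε x : ℂ)⁻¹ * flux ε g x) (Ioi (-1)) := by
  obtain ⟨a, b, -, -, hb, h⟩ := exists_eq_zero_of_mem_testFun hg
  intro x hx
  refine ContDiffAt.contDiffWithinAt ?_
  rcases lt_or_ge x 1 with h1 | h1
  · have hp := p_pos ε ⟨hx, h1⟩
    refine ContDiffAt.mul (ContDiffAt.inv ?_ ?_) (contDiff_flux hg).contDiffAt
    · exact Complex.ofRealCLM.contDiff.contDiffAt.comp _ (contDiffAt_p ε ⟨hx, h1⟩)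
    · exact_mod_cast hp.ne'
  · refine contDiffAt_const (c := (0 : ℂ)) |>.congr_of_eventuallyEq ?_
    filter_upwards [isOpen_Ioi.mem_nhds (hb.trans_le h1 : x ∈ Ioi b)] with y hy
    rw [flux_eq_zero hb h hy, mul_zero]

theorem hasDerivAt_solution (hg : g ∈ testFun) {x : ℝ} (hx : -1 < x) :
    HasDerivAt (solution ε g) ((p ε x : ℂ)⁻¹ * flux ε g x) x :=
  hasDerivAt_integral_of_continuousOn isOpen_Ioi ordConnected_Ioi
    (contDiffOn_inv_p_mul_flux hg).continuousOn (by norm_num) hx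

theorem contDiffOn_solution (hg : g ∈ testFun) : ContDiffOn ℝ ∞ (solution ε g) (Ioi (-1)) :=
  contDiffOn_integral isOpen_Ioi ordConnected_Ioi (contDiffOn_inv_p_mul_flux hg) (by norm_num)

theorem solution_mem_smoothZero (hg : g ∈ testFun) : solution ε g ∈ smoothZero :=
  ⟨(contDiffOn_solution hg).mono fun _ hx => neg_one_lt_zero.trans_le hx.1,
    intervalIntegral.integral_same⟩

theorem expr_solution (hg : g ∈ testFun) {x : ℝ} (hx : x ∈ Ioo (0 : ℝ) 1) :
    expr ε (solution ε g) x = g x := by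
  have h1 : (fun y => (p ε y : ℂ) * deriv (solution ε g) y) =ᶠ[nhds x] flux ε g := by
    filter_upwards [isOpen_Ioo.mem_nhds hx] with y hy
    have hy' : -1 < y := by linarith [hy.1]
    have hp : (p ε y : ℂ) ≠ 0 := by exact_mod_cast (p_pos ε ⟨hy', hy.2⟩).ne'
    rw [(hasDerivAt_solution hg hy').deriv, mul_inv_cancel_left₀ hp]
  have hw : (w ε x : ℂ) ≠ 0 := by exact_mod_cast (w_pos ε hx).ne'
  rw [expr, h1.deriv_eq, (hasDerivAt_flux hg x).deriv, mul_neg, neg_neg, inv_mul_cancel_left₀ hw]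

theorem exprL2w_solution (hε : 0 < ε) (hg : g ∈ testFun) :
    exprL2w hε ⟨solution ε g, solution_mem_smoothZero hg⟩ =
      toL2w hε ⟨g, testFun_le_smoothZero hg⟩ :=
  MemLp.toLp_congr (memLp_expr hε (solution_mem_smoothZero hg))
    (memLp_smooth hε (testFun_le_smoothZero hg))
    (ae_wMeasure_of_forall ε fun _ hx => expr_solution hg hx)

/-- The range contains every test function `g`, as the image of `solution ε g`. -/
theorem denseRange_L (hε : 0 < ε) : DenseRange (L hε) := by
  have : Dense (LinearMap.range (L hε).toFun : Set (L2w ε)) := by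
    rw [Submodule.dense_iff_topologicalClosure_eq_top, Submodule.topologicalClosure_eq_top_iff,
      Submodule.eq_bot_iff]
    intro u hu
    refine eq_zero_of_inner_testFun hε fun f => (Submodule.mem_orthogonal' _ u).1 hu _ ?_
    exact ⟨_, (L_apply hε _).trans (exprL2w_solution hε f.2)⟩
  rwa [LinearMap.coe_range] at this

theorem continuous_w_mul_invPrimitive_mul (hg : g ∈ testFun) :
    Continuous fun x => (w ε x : ℂ) * (invPrimitive ε x * g x) := by
  refine (w_mul_mem_testFun ε (mul_mem_testFun (fun x hx => ?_) hg)).1.continuous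
  have hx' : x ∈ Ioo (-1 : ℝ) 1 := ⟨by linarith [hx.1], hx.2⟩
  exact Complex.ofRealCLM.contDiff.contDiffAt.comp _
    ((contDiffOn_invPrimitive ε).contDiffAt (isOpen_Ioo.mem_nhds hx'))

/-- Integrate `(P · flux)' = flux/p - w P g` over `[0,c]`: the boundary terms vanish because `P(0) =
0` and the flux is zero at `c`. The solution is thus constant between the support of `g` and `1`,
with value the pairing of `g` with `P`. -/
theorem solution_eq_integral (hg : g ∈ testFun) {a b : ℝ} (hb : b < 1)
    (h : ∀ x ∉ Icc a b, g x = 0) {c : ℝ} (hc0 : 0 ≤ c) (hbc : b < c) (hc1 : c < 1) :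
    solution ε g c = ∫ x in (0 : ℝ)..1, (w ε x : ℂ) * (invPrimitive ε x * g x) := by
  have hcont := continuous_w_mul_invPrimitive_mul (ε := ε) hg
  have hmem : ∀ x ∈ uIcc 0 c, x ∈ Ioo (-1 : ℝ) 1 := fun x hx => by
    rw [uIcc_of_le hc0] at hx
    exact ⟨by linarith [hx.1], by linarith [hx.2]⟩
  have hi1 : IntervalIntegrable (fun x => (p ε x : ℂ)⁻¹ * flux ε g x) volume 0 c :=
    ((contDiffOn_inv_p_mul_flux hg).continuousOn.mono fun x hx => (hmem x hx).1).intervalIntegrable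
  have key := intervalIntegral.integral_eq_sub_of_hasDerivAt
    (f := fun x => (invPrimitive ε x : ℂ) * flux ε g x)
    (f' := fun x => (p ε x : ℂ)⁻¹ * flux ε g x - (w ε x : ℂ) * (invPrimitive ε x * g x))
    (fun x hx => by
      refine ((hasDerivAt_invPrimitive ε (hmem x hx)).ofReal_comp.mul
        (hasDerivAt_flux hg x)).congr_deriv ?_
      push_cast
      ring) (hi1.sub (hcont.intervalIntegrable 0 c))
  rw [intervalIntegral.integral_sub hi1 (hcont.intervalIntegrable 0 c), invPrimitive_zero,
    flux_eq_zero hb h hbc, mul_zero, Complex.ofReal_zero, zero_mul, sub_zero, sub_eq_zero] at key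
  have h0 : ∫ x in c..1, (w ε x : ℂ) * (invPrimitive ε x * g x) = 0 := by
    rw [intervalIntegral.integral_congr (g := fun _ => 0), intervalIntegral.integral_zero]
    intro t ht
    have ht1 : b < t := (lt_min hbc hb).trans_le ht.1
    simp only [h t fun h' => ht1.not_ge h'.2, mul_zero]
  rw [solution, key, ← intervalIntegral.integral_add_adjacent_intervals
    (hcont.intervalIntegrable 0 c) (hcont.intervalIntegrable c 1), h0, add_zero]

/-- The solution is a test function if `w g` is orthogonal to both solutions of `(p f')' = 0`. -/
theorem solution_mem_testFun (hg : g ∈ testFun)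
    (h0 : ∫ x in (0 : ℝ)..1, (w ε x : ℂ) * g x = 0)
    (h1 : ∫ x in (0 : ℝ)..1, (w ε x : ℂ) * (invPrimitive ε x * g x) = 0) :
    solution ε g ∈ testFun := by
  obtain ⟨a, b, ha, hab, hb, h⟩ := exists_eq_zero_of_mem_testFun hg
  have hl : ∀ x < a, (p ε x : ℂ)⁻¹ * flux ε g x = 0 := fun x hx => by
    rw [flux_eq_integral hg ha h hx, h0, mul_zero]
  have hr : ∀ x > b, (p ε x : ℂ)⁻¹ * flux ε g x = 0 := fun x hx => by
    rw [flux_eq_zero hb h hx, mul_zero]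
  have hF : ContDiff ℝ ∞ fun x => (p ε x : ℂ)⁻¹ * flux ε g x := by
    refine contDiff_iff_contDiffAt.2 fun x => ?_
    rcases lt_or_ge x a with hx | hx
    · refine contDiffAt_const (c := (0 : ℂ)) |>.congr_of_eventuallyEq ?_
      filter_upwards [isOpen_Iio.mem_nhds hx] with y hy using hl y hy
    · exact (contDiffOn_inv_p_mul_flux hg).contDiffAt
        (isOpen_Ioi.mem_nhds (by linarith : (-1 : ℝ) < x))
  have hs : ContDiff ℝ ∞ (solution ε g) := contDiffOn_univ.1
    (contDiffOn_integral isOpen_univ ordConnected_univ hF.contDiffOn (mem_univ _))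
  refine mem_testFun_of_eq_zero hs ha hb fun x hx => ?_
  rcases lt_or_ge x a with hxa | hxa
  · rw [solution, intervalIntegral.integral_congr (g := fun _ => 0), intervalIntegral.integral_zero]
    exact fun t ht => hl t (ht.2.trans_lt (max_lt ha hxa))
  · have hxb : b < x := not_le.1 fun h' => hx ⟨hxa, h'⟩
    -- The point `x` may lie beyond `1`, so the value is computed at the midpoint of `b` and `1` and
    -- carried to `x`, the integrand being zero past `b`.
    have hbc : b < (b + 1) / 2 := by linarith
    have hc := solution_eq_integral (ε := ε) hg hb h (c := (b + 1) / 2) (by linarith) hbc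
      (by linarith)
    have h2 : ∫ t in (b + 1) / 2..x, (p ε t : ℂ)⁻¹ * flux ε g t = 0 := by
      rw [intervalIntegral.integral_congr (g := fun _ => 0), intervalIntegral.integral_zero]
      exact fun t ht => hr t ((lt_min hbc hxb).trans_le ht.1)
    rw [solution, ← intervalIntegral.integral_add_adjacent_intervals
      (hF.continuous.intervalIntegrable 0 ((b + 1) / 2)) (hF.continuous.intervalIntegrable _ x), h2,
      add_zero]
    exact hc.trans h1

/-! ### For `ε ≤ 1`, no solution of `(p f')' = 0` is square integrable -/

theorem not_integrableOn_of_inv_le {f : ℝ → ℝ} {δ C : ℝ} (hδ : 0 < δ)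
    (h : ∀ x ∈ Ioo 0 δ, x⁻¹ ≤ C * f x) : ¬ IntegrableOn f (Ioo 0 δ) := by
  intro hf
  have h1 : IntegrableOn (fun x : ℝ => x⁻¹) (Ioo 0 δ) := by
    refine (hf.const_mul C).mono' measurable_inv.aestronglyMeasurable
      (ae_restrict_of_forall_mem measurableSet_Ioo fun x hx => ?_)
    rw [Real.norm_of_nonneg (inv_nonneg.2 hx.1.le)]
    exact h x hx
  rw [← intervalIntegrable_iff_integrableOn_Ioo_of_le hδ.le, intervalIntegrable_inv_iff] at h1
  rcases h1 with h1 | h1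
  · exact hδ.ne h1
  · exact h1 left_mem_uIcc

theorem not_integrableOn_of_inv_one_sub_le {f : ℝ → ℝ} {b C : ℝ} (hb : b < 1)
    (h : ∀ x ∈ Ioo b 1, (1 - x)⁻¹ ≤ C * f x) : ¬ IntegrableOn f (Ioo b 1) := by
  intro hf
  have h1 : IntegrableOn (fun x : ℝ => (x - 1)⁻¹) (Ioo b 1) := by
    refine (hf.const_mul C).mono' (measurable_id.sub_const 1).inv.aestronglyMeasurable
      (ae_restrict_of_forall_mem measurableSet_Ioo fun x hx => ?_)
    rw [norm_inv, Real.norm_eq_abs, abs_sub_comm, abs_of_pos (sub_pos.2 hx.2)]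
    exact h x hx
  rw [← intervalIntegrable_iff_integrableOn_Ioo_of_le hb.le, intervalIntegrable_sub_inv_iff] at h1
  rcases h1 with h1 | h1
  · exact hb.ne h1
  · exact h1 right_mem_uIcc

/-- A function with a nonzero limit at `0` is not square integrable. -/
theorem eq_zero_of_memLp_of_continuousAt {u : ℝ → ℂ} (hu : MemLp u 2 (wMeasure ε))
    (hc : ContinuousAt u 0) : u 0 = 0 := by
  by_contra hne
  have hpos : 0 < ‖u 0‖ ^ 2 := by positivity
  have hcont : ContinuousAt
      (fun x : ℝ => (1 - x) ^ (1 / ε) * (x + 1) ^ (-(1 / ε)) * ‖u x‖ ^ 2) 0 := by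
    refine ContinuousAt.mul (ContinuousAt.mul ?_ ?_) (hc.norm.pow 2)
    · exact (continuousAt_const.sub continuousAt_id).rpow_const (Or.inl (by norm_num))
    · exact (continuousAt_id.add continuousAt_const).rpow_const (Or.inl (by norm_num))
  -- Near `0` the continuous function `x w |u|²` exceeds half of its limit `‖u 0‖²`, so `w |u|²`
  -- dominates a multiple of `1/x`.
  have hev := hcont.eventually (lt_mem_nhds (a := ‖u 0‖ ^ 2 / 2) (by
    simp only [sub_zero, zero_add, Real.one_rpow, one_mul]
    linarith))
  obtain ⟨δ, hδ, hball⟩ := Metric.eventually_nhds_iff.1 hev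
  have hδ' : 0 < min δ 1 := lt_min hδ one_pos
  refine not_integrableOn_of_inv_le (f := fun x => w ε x * ‖u x‖ ^ 2) (C := 2 / ‖u 0‖ ^ 2) hδ'
    (fun x hx => ?_)
    ((integrableOn_w_mul_norm_sq hu).mono_set (Ioo_subset_Ioo_right (min_le_right _ _)))
  have hx0 := hx.1
  have hlt := hball (y := x) (by
    rw [Real.dist_eq, sub_zero, abs_of_pos hx0]
    exact hx.2.trans_le (min_le_left _ _))
  have e : 2 / ‖u 0‖ ^ 2 * (w ε x * ‖u x‖ ^ 2) = x⁻¹ *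
      ((1 - x) ^ (1 / ε) * (x + 1) ^ (-(1 / ε)) * ‖u x‖ ^ 2 / (‖u 0‖ ^ 2 / 2)) := by
    unfold w
    field_simp
  rw [e]
  refine le_mul_of_one_le_right (inv_nonneg.2 hx0.le) ?_
  rw [one_le_div (by positivity)]
  exact hlt.le

/-- For `ε ≤ 1` the factor `(1+y)^(1-1/ε)` is at most `1`, so `1/p ≥ (1-y)^(-1-1/ε)`, which has
primitive `ε (1-y)^(-1/ε)`. -/
theorem le_invPrimitive (hε : 0 < ε) (hε1 : ε ≤ 1) {x : ℝ} (hx : x ∈ Ioo (0 : ℝ) 1) :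
    ε * ((1 - x) ^ (-(1 / ε)) - 1) ≤ invPrimitive ε x := by
  have hsub : ∀ y ∈ Icc 0 x, 0 < 1 - y := fun y hy => by linarith [hy.2, hx.2]
  have hd : ∀ y ∈ Icc 0 x, HasDerivAt (fun y => ε * (1 - y) ^ (-(1 / ε)))
      ((1 - y) ^ (-(1 / ε) - 1)) y := fun y hy => by
    refine ((((hasDerivAt_id y).const_sub 1).rpow_const (p := -(1 / ε))
      (Or.inl (hsub y hy).ne')).const_mul ε).congr_deriv ?_
    simp only [id]
    field_simp
  have key := intervalIntegral.sub_le_integral_of_hasDeriv_right_of_le hx.1.le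
    (fun y hy => (hd y hy).continuousAt.continuousWithinAt)
    (fun y hy => (hd y (Ioo_subset_Icc_self hy)).hasDerivWithinAt) (φ := fun y => (p ε y)⁻¹)
    (by
      refine ContinuousOn.integrableOn_Icc ((contDiffOn_inv_p ε).continuousOn.mono fun y hy => ?_)
      exact ⟨by linarith [hy.1], by linarith [hy.2, hx.2]⟩)
    (fun y hy => by
      have hy0 := hsub y (Ioo_subset_Icc_self hy)
      have h1 : (y + 1) ^ (1 - 1 / ε) ≤ 1 := by
        refine Real.rpow_le_one_of_one_le_of_nonpos (by linarith [hy.1]) ?_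
        rw [sub_nonpos, one_le_div hε]
        exact hε1
      have e : (1 - y) ^ (-(1 / ε) - 1) = ((1 - y) ^ (1 + 1 / ε))⁻¹ := by
        rw [← Real.rpow_neg hy0.le]
        congr 1
        ring
      rw [e]
      refine inv_anti₀ (p_pos ε ⟨by linarith [hy.1], by linarith⟩) ?_
      exact mul_le_of_le_one_right (by positivity) h1)
  simp only [sub_zero, Real.one_rpow] at key
  calc _ = ε * (1 - x) ^ (-(1 / ε)) - ε * 1 := by ring
    _ ≤ _ := key

/-- With `t = (1-x)^(1/ε)`, near `1` the weight is at least of order `t` and `P` at least of order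
`1/t`. So `w P²` is at least of order `1/t ≥ 1/(1-x)`, the last step because `1/ε ≥ 1`. -/
theorem not_memLp_invPrimitive (hε : 0 < ε) (hε1 : ε ≤ 1) :
    ¬ MemLp (fun x => (invPrimitive ε x : ℂ)) 2 (wMeasure ε) := by
  intro hu
  have he : 1 ≤ 1 / ε := (one_le_div hε).2 hε1
  have he0 : 0 < 1 / ε := by positivity
  -- On `(1/2, 1)` one has `1 - t ≥ κ`, hence `1/t - 1 ≥ κ/t`; the constant `m` below bounds
  -- `(1+x)^(-1/ε)` from below.
  set κ : ℝ := 1 - (1 / 2) ^ (1 / ε) with hκ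
  have hκ0 : 0 < κ := sub_pos.2 (Real.rpow_lt_one (by norm_num) (by norm_num) he0)
  set m : ℝ := 2 ^ (-(1 / ε)) with hm
  have hm0 : 0 < m := by positivity
  refine not_integrableOn_of_inv_one_sub_le (b := 1 / 2) (by norm_num)
    (f := fun x => w ε x * ‖(invPrimitive ε x : ℂ)‖ ^ 2) (C := (m * (ε * κ) ^ 2)⁻¹)
    (fun x hx => ?_)
    ((integrableOn_w_mul_norm_sq hu).mono_set (Ioo_subset_Ioo_left (by norm_num)))
  have hx01 : x ∈ Ioo (0 : ℝ) 1 := ⟨by linarith [hx.1], hx.2⟩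
  have hx0 := hx01.1
  have h1x : 0 < 1 - x := sub_pos.2 hx.2
  have hP := le_invPrimitive hε hε1 hx01
  set t : ℝ := (1 - x) ^ (1 / ε) with ht
  have ht0 : 0 < t := by positivity
  rw [Real.rpow_neg h1x.le, ← ht] at hP
  have ht1 : t ≤ 1 - x := by
    calc t ≤ (1 - x) ^ (1 : ℝ) :=
          Real.rpow_le_rpow_of_exponent_ge h1x (by linarith) he
      _ = 1 - x := Real.rpow_one _
  have ht2 : t ≤ 1 - κ := by
    rw [hκ, sub_sub_cancel]
    exact Real.rpow_le_rpow h1x.le (by linarith [hx.1]) he0.le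
  have hP2 : ε * κ / t ≤ invPrimitive ε x := by
    refine le_trans ?_ hP
    rw [mul_div_assoc]
    refine mul_le_mul_of_nonneg_left ?_ hε.le
    rw [div_le_iff₀ ht0, sub_mul, inv_mul_cancel₀ ht0.ne']
    linarith
  have hw : m * t ≤ w ε x := by
    have h1 : m ≤ (x + 1) ^ (-(1 / ε)) :=
      Real.rpow_le_rpow_of_nonpos (by linarith) (by linarith [hx.2]) (by linarith)
    have h2 : 1 ≤ x⁻¹ := (one_le_inv₀ hx0).2 hx.2.le
    unfold w
    rw [← ht]
    calc m * t = 1 * t * m := by ring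
      _ ≤ x⁻¹ * t * (x + 1) ^ (-(1 / ε)) := by gcongr
  have hw0 := (w_pos ε hx01).le
  rw [Complex.norm_real, Real.norm_eq_abs, sq_abs]
  calc (1 - x)⁻¹ ≤ t⁻¹ := inv_anti₀ ht0 ht1
    _ = (m * (ε * κ) ^ 2)⁻¹ * (m * t * (ε * κ / t) ^ 2) := by field_simp
    _ ≤ _ := by gcongr

/-- As `P(0) = 0`, the value at `0` is `α`, which must vanish; then `β ≠ 0` would make `P` square
integrable. The form `α * 1` matches the pairing with the constant function `1`. -/
theorem eq_zero_of_memLp_add (hε : 0 < ε) (hε1 : ε ≤ 1) {α β : ℂ}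
    (h : MemLp (fun x => α * 1 + β * (invPrimitive ε x : ℂ)) 2 (wMeasure ε)) : α = 0 ∧ β = 0 := by
  have hc : ContinuousAt (fun x => α * 1 + β * (invPrimitive ε x : ℂ)) 0 := by
    have := (hasDerivAt_invPrimitive ε (x := 0) (by norm_num)).continuousAt
    exact continuousAt_const.add
      (continuousAt_const.mul (Complex.continuous_ofReal.continuousAt.comp this))
  have hα : α = 0 := by
    simpa [invPrimitive_zero] using eq_zero_of_memLp_of_continuousAt h hc
  refine ⟨hα, by_contra fun hβ => not_memLp_invPrimitive hε hε1 ?_⟩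
  have h2 := h.const_mul β⁻¹
  refine (memLp_congr_ae (Filter.Eventually.of_forall fun x => ?_)).1 h2
  simp [hα, hβ]

theorem locallyIntegrableOn_one (ε : ℝ) :
    LocallyIntegrableOn (fun x => (w ε x : ℂ) * (1 : ℂ)) (Ioo 0 1) :=
  ((continuousOn_w ε).mul continuousOn_const).locallyIntegrableOn measurableSet_Ioo

theorem locallyIntegrableOn_invPrimitive (ε : ℝ) :
    LocallyIntegrableOn (fun x => (w ε x : ℂ) * (invPrimitive ε x : ℂ)) (Ioo 0 1) := by
  refine ((continuousOn_w ε).mul (Complex.continuous_ofReal.comp_continuousOn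
    ((contDiffOn_invPrimitive ε).continuousOn.mono fun x hx => ?_))).locallyIntegrableOn
    measurableSet_Ioo
  exact ⟨by linarith [hx.1], hx.2⟩

theorem exprL2w_mem_range_Lc (hε : 0 < ε) {f : ℝ → ℂ} (hf : f ∈ testFun) :
    exprL2w hε ⟨f, testFun_le_smoothZero hf⟩ ∈ LinearMap.range (Lc hε).toFun := by
  have hd : toL2w hε ⟨f, testFun_le_smoothZero hf⟩ ∈ (Lc hε).domain := by
    rw [Lc_domain]
    exact ⟨_, hf, rfl⟩
  refine ⟨⟨_, hd⟩, ?_⟩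
  rw [← L_apply]
  rfl

theorem denseRange_Lc (hε : 0 < ε) (hε1 : ε ≤ 1) : DenseRange (Lc hε) := by
  have : Dense (LinearMap.range (Lc hε).toFun : Set (L2w ε)) := by
    rw [Submodule.dense_iff_topologicalClosure_eq_top, Submodule.topologicalClosure_eq_top_iff,
      Submodule.eq_bot_iff]
    intro u hu
    have hlu := locallyIntegrableOn_of_memLp hε (Lp.memLp u)
    have hl1 := locallyIntegrableOn_one ε
    have hl2 := locallyIntegrableOn_invPrimitive ε
    -- A test function `g` annihilated by the pairings with `1` and `P` is the image under `L_c` of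
    -- its compactly supported solution, hence orthogonal to `u`. By linear algebra the pairing with
    -- `ū` is a combination of these two functionals.
    have hspan := mem_span_of_iInf_ker_le_ker
      (L := ![pairing hl1, pairing hl2]) (K := pairing hlu) fun g hg => by
        rw [Submodule.mem_iInf] at hg
        have h0 : ∫ x in (0 : ℝ)..1, (w ε x : ℂ) * (1 * g.1 x) = 0 := hg 0
        have h1 : ∫ x in (0 : ℝ)..1, (w ε x : ℂ) * (invPrimitive ε x * g.1 x) = 0 := hg 1
        simp only [one_mul] at h0
        have hs := solution_mem_testFun g.2 h0 h1
        rw [LinearMap.mem_ker, ← inner_toL2w hε u g, ← exprL2w_solution hε g.2]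
        exact (Submodule.mem_orthogonal' _ u).1 hu _ (exprL2w_mem_range_Lc hε hs)
    rw [Matrix.range_cons, Matrix.range_cons, Matrix.range_empty, union_empty,
      singleton_union, Submodule.mem_span_pair] at hspan
    obtain ⟨α, β, hαβ⟩ := hspan
    have hl3 : LocallyIntegrableOn (fun x => (w ε x : ℂ) *
        (conj (u x) - (α * 1 + β * (invPrimitive ε x : ℂ)))) (Ioo 0 1) := by
      have := hlu.sub ((hl1.smul α).add (hl2.smul β))
      convert this using 1
      ext x
      simp only [Pi.sub_apply, Pi.add_apply, Pi.smul_apply, smul_eq_mul]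
      ring
    have hz : pairing hl3 = 0 := by
      ext g
      have hg := LinearMap.congr_fun hαβ g
      have i1 := (intervalIntegrable_pairing hl1 g.2).const_mul α
      have i2 := (intervalIntegrable_pairing hl2 g.2).const_mul β
      have i3 := intervalIntegrable_pairing hlu g.2
      change α * (∫ x in (0 : ℝ)..1, (w ε x : ℂ) * (1 * g.1 x)) +
        β * (∫ x in (0 : ℝ)..1, (w ε x : ℂ) * (invPrimitive ε x * g.1 x)) =
        ∫ x in (0 : ℝ)..1, (w ε x : ℂ) * (conj (u x) * g.1 x) at hg
      change ∫ x in (0 : ℝ)..1, (w ε x : ℂ) *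
        ((conj (u x) - (α * 1 + β * (invPrimitive ε x : ℂ))) * g.1 x) = 0
      rw [← intervalIntegral.integral_const_mul, ← intervalIntegral.integral_const_mul,
        ← intervalIntegral.integral_add i1 i2] at hg
      rw [← sub_eq_zero.2 hg.symm, ← intervalIntegral.integral_sub i3 (i1.add i2)]
      congr 1
      ext x
      ring
    have hae := ae_eq_zero_of_pairing_eq_zero hl3 hz
    -- Here `ū = α + βP` almost everywhere, so the combination inherits square integrability from
    -- `u`.
    have hmem : MemLp (fun x => α * 1 + β * (invPrimitive ε x : ℂ)) 2 (wMeasure ε) := by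
      refine (memLp_congr_ae ?_).1 (Lp.memLp u).star
      filter_upwards [hae] with x hx
      exact sub_eq_zero.1 hx
    obtain ⟨rfl, rfl⟩ := eq_zero_of_memLp_add hε hε1 hmem
    refine (Lp.eq_zero_iff_ae_eq_zero).2 ?_
    filter_upwards [hae] with x hx
    simpa using hx
  rwa [LinearMap.coe_range] at this

end SturmLiouville

end

theorem mainTheorem3 (ε : ℝ) (hε : 0 < ε) (hε2 : ε < 2) :
    (SturmLiouville.L hε).IsEssentiallySelfAdjoint ∧
      (ε ≤ 1 →
        (SturmLiouville.Lc hε).IsClosable ∧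
          (SturmLiouville.Lc hε).closure = (SturmLiouville.L hε).closure) := by
  have hpos : 0 < 2 / ε := by positivity
  have hb := SturmLiouville.L_bounded_below hε
  have hL := (SturmLiouville.L_isFormalAdjoint hε).isEssentiallySelfAdjoint
    (SturmLiouville.dense_L_domain hε) hpos hb (SturmLiouville.denseRange_L hε)
  have hle : SturmLiouville.Lc hε ≤ SturmLiouville.L hε := LinearPMap.domRestrict_le
  refine ⟨hL, fun hε1 => ⟨hL.2.2.1.leIsClosable hle, ?_⟩⟩
  exact LinearPMap.closure_eq_of_le_of_denseRange hle hL.2.2.1 hpos hb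
    (SturmLiouville.denseRange_Lc hε hε1)
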